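/- For an open set $\Omega\subset\mathbb{R}^n$ and a set $\Sigma\subset\partial\Omega$ let $$H(\Omega,\Sigma)=\inf_{u\in H^1_0(\Omega),\ u\neq 0}\ \frac{\int_\Omega|\nabla u|^2\,dx}{\int_\Omega u^2/d_\Sigma^2\,dx},\qquad d_\Sigma(x)=\operatorname{dist}(x,\Sigma),$$ be the Hardy constant, where the quotient is read as $0$ if its denominator is infinite. Let $\Omega\subset\mathbb{R}^n$ be a bounded open set with smooth ($C^\infty$) non-empty boundary, and let $\Sigma\subset\partial\Omega$ be an arbitrary non-empty subset of the boundary. Then $H(\Omega,\Sigma)<\infty$, and there exist $\varepsilon>0$ and $c>0$ such that for every $C^1$ diffeomorphism $\varphi\in \mathrm{Diff}^1(\partial\Omega)$ of $\partial\Omega$ onto itself with $\|\varphi-\mathrm{id}\|_{C^1(\partial\Omega)}<\varepsilon$, $$|H(\Omega,\varphi(\Sigma))-H(\Omega,\Sigma)|\le c\,H(\Omega,\Sigma)\,\|\varphi-\mathrm{id}\|_{C^1(\partial\Omega)}.$$ Here, for a $C^1$ map $f:\partial\Omega\to\mathbb{R}^n$, $$\|f\|_{C^1(\partial\Omega)}=\sup_{x\in\partial\Omega}|f(x)|+\sup_{x\in\partial\Omega}\|d_xf\|,$$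 where $\|d_xf\|$ is the operator norm of the differential $d_xf:T_x\partial\Omega\to\mathbb{R}^n$. -/

import Mathlib

open Set MeasureTheory
open scoped ENNReal ContDiff

noncomputable section

/-- `ℝⁿ` with its Euclidean norm, inner product and Lebesgue measure. -/
abbrev Rn (n : ℕ) : Type := EuclideanSpace ℝ (Fin n)

/-! ### The Sobolev space `H¹₀(Ω)` -/

/-- `ψ ∈ C_c^∞(Ω)`. -/
structure IsTestFunction {n : ℕ} (Ω : Set (Rn n)) (ψ : Rn n → ℝ) : Prop where
  smooth : ContDiff ℝ ∞ ψ
  hasCompactSupport : HasCompactSupport ψ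
  tsupport_subset : tsupport ψ ⊆ Ω

/-- `g` is the weak (distributional) gradient of `u` on `Ω`:
`∫_Ω u ∇ψ = - ∫_Ω ψ g` for every `ψ ∈ C_c^∞(Ω)`. -/
def IsWeakGradient {n : ℕ} (Ω : Set (Rn n)) (u : Rn n → ℝ) (g : Rn n → Rn n) : Prop :=
  ∀ ψ : Rn n → ℝ, IsTestFunction Ω ψ →
    ∫ x in Ω, u x • gradient ψ x = -∫ x in Ω, ψ x • g x

/-- `u ∈ H¹(Ω)` with weak gradient `g`: both are in `L²(Ω)`. Only the values on `Ω` matter. -/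
structure MemH1 {n : ℕ} (Ω : Set (Rn n)) (u : Rn n → ℝ) (g : Rn n → Rn n) : Prop where
  memLp : MemLp u 2 (volume.restrict Ω)
  memLp_grad : MemLp g 2 (volume.restrict Ω)
  isWeakGradient : IsWeakGradient Ω u g

/-- `u ∈ H¹₀(Ω)` with weak gradient `g`: `u` lies in the closure of `C_c^∞(Ω)` in `H¹(Ω)`. -/
structure MemH10 {n : ℕ} (Ω : Set (Rn n)) (u : Rn n → ℝ) (g : Rn n → Rn n) : Prop
    extends MemH1 Ω u g where
  approx : ∀ δ : ℝ≥0∞, 0 < δ → ∃ ψ : Rn n → ℝ, IsTestFunction Ω ψ ∧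
    eLpNorm (fun x => u x - ψ x) 2 (volume.restrict Ω) < δ ∧
    eLpNorm (fun x => g x - gradient ψ x) 2 (volume.restrict Ω) < δ

/-! ### The Hardy constant -/

/-- The Rayleigh quotient `∫_Ω |∇u|² / ∫_Ω u² / d_S²`, with `g = ∇u` and `d_S = dist(·, S)`. The
integrands are nonnegative and the integrals take values in `[0, ∞]`; the quotient is `0` when the
denominator is infinite and the numerator is finite. -/
def hardyQuotient {n : ℕ} (Ω S : Set (Rn n)) (u : Rn n → ℝ) (g : Rn n → Rn n) : ℝ≥0∞ :=
  (∫⁻ x in Ω, ‖g x‖ₑ ^ 2) / ∫⁻ x in Ω, ‖u x‖ₑ ^ 2 / Metric.infEDist x S ^ 2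

/-- The Hardy constant `H(Ω, S)`: the infimum of the Rayleigh quotient over the nonzero
`u ∈ H¹₀(Ω)`. -/
def hardyConstant {n : ℕ} (Ω S : Set (Rn n)) : ℝ≥0∞ :=
  ⨅ (u : Rn n → ℝ) (g : Rn n → Rn n) (_ : MemH10 Ω u g)
    (_ : ¬ u =ᵐ[volume.restrict Ω] 0), hardyQuotient Ω S u g

/-! ### Smooth boundaries and `C¹` diffeomorphisms of the boundary -/

/-- `∂Ω` is smooth: near each of its points, `Ω` is the sublevel set `{F < 0}` of a `C^∞` function
`F` whose differential does not vanish. -/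
def HasSmoothBoundary {n : ℕ} (Ω : Set (Rn n)) : Prop :=
  ∀ x ∈ frontier Ω, ∃ U : Set (Rn n), IsOpen U ∧ x ∈ U ∧ ∃ F : Rn n → ℝ,
    ContDiffOn ℝ ∞ F U ∧ (∀ y ∈ U, fderiv ℝ F y ≠ 0) ∧ Ω ∩ U = {y ∈ U | F y < 0}

/-- `φ` restricts to a `C¹` diffeomorphism of `M` onto itself; only the values of `φ` on `M` matter.
For an embedded submanifold `M`, `ContDiffOn ℝ 1 · M` is being `C¹` in charts of `M`, equivalently
having a `C¹` extension to a neighbourhood of each point of `M`. -/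
structure IsC1Diffeo {n : ℕ} (M : Set (Rn n)) (φ : Rn n → Rn n) : Prop where
  mapsTo : MapsTo φ M M
  contDiffOn : ContDiffOn ℝ 1 φ M
  exists_inverse : ∃ ψ : Rn n → Rn n, MapsTo ψ M M ∧ ContDiffOn ℝ 1 ψ M ∧ InvOn ψ φ M M

/-- The tangent space `T_x M`, as a linear subspace of `ℝⁿ`. -/
def tangentSubspace {n : ℕ} (M : Set (Rn n)) (x : Rn n) : Submodule ℝ (Rn n) :=
  Submodule.span ℝ (tangentConeAt ℝ M x)

/-- The norm `‖f‖_{C¹(M)} = sup_{x ∈ M} |f(x)| + sup_{x ∈ M} ‖d_x f : T_x M → ℝⁿ‖` of a `C¹` map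
`f : M → ℝⁿ`. Any two derivatives of `f` within `M` at `x` agree on `T_x M`, so the restriction
of `fderivWithin` to `T_x M` is the differential of `f` along `M`. -/
def c1Norm {n : ℕ} (M : Set (Rn n)) (f : Rn n → Rn n) : ℝ≥0∞ :=
  (⨆ x ∈ M, ‖f x‖ₑ) +
    ⨆ x ∈ M, ‖(fderivWithin ℝ f M x).comp (tangentSubspace M x).subtypeL‖ₑ

end

/-! The boundary map `φ` extends to a homeomorphism `Φ` of the whole space that preserves `Ω`, such
that `Φ` and `Φ⁻¹` are Lipschitz with constant `K = 1 + A‖φ - id‖` (`exists_homeomorph_extension`).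
Transporting test functions by `Φ⁻¹` changes energy, volume and distance to the set by powers of `K`
only, so `H(Ω, φ(S)) ≤ K ^ (2(n+2)) H(Ω, S)` (`hardyConstant_image_le`), and the same argument for
`Φ⁻¹` gives the reverse comparison. Since `K ^ m - 1` is linear in `‖φ - id‖` up to a constant, the
estimate follows.

For the extension, nearby points of the compact smooth `∂Ω` are joined by curves in `∂Ω` of
comparable length, so the `C¹` norm of `f = φ - id` bounds its Lipschitz constant. A Lipschitz
extension `e` of `f` with constant at most `1/2` makes `Φ = id + e` bi-Lipschitz. `Φ` preserves
`∂Ω`, but `Ω` may be disconnected, so its invariance needs more: each point of `Ω` is connected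
inside `Ω` to the centre of a ball of uniform radius, a centre that `Φ` cannot move out of `Ω`, and
a connected image missing `∂Ω` cannot leave `Ω` (`mapsTo_of_dist_lt`).

Transported functions are merely Lipschitz, so they are placed in `H¹₀` by mollification;
conversely, Fatou's lemma reduces lower bounds on `H` to test functions. -/

/-! ### Local geometry of a smooth boundary: curves and Lipschitz bounds. -/

section Boundary

open Filter Topology

/-- A map that is `C¹` near `y` with identity derivative at `y` has derivatives of norm `≤ 2`
near `y`. -/
theorem exists_ball_norm_fderiv_le_two {E : Type*} [NormedAddCommGroup E] [NormedSpace ℝ E]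
    {G : E → E} {y : E} (hG : ContDiffAt ℝ 1 G y)
    (hG' : HasFDerivAt G (ContinuousLinearMap.id ℝ E) y) :
    ∀ᶠ z in 𝓝 y, DifferentiableAt ℝ G z ∧ ‖fderiv ℝ G z‖ ≤ 2 := by
  have h1 : ∀ᶠ z in 𝓝 y, DifferentiableAt ℝ G z :=
    (hG.eventually (by simp)).mono fun z hz => hz.differentiableAt one_ne_zero
  have h2 : ContinuousAt (fderiv ℝ G) y :=
    (hG.fderiv_right (m := 0) (by simp)).continuousAt
  have h3 : ‖fderiv ℝ G y‖ < 2 := by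
    rw [hG'.fderiv]
    exact ContinuousLinearMap.norm_id_le.trans_lt one_lt_two
  filter_upwards [h1, h2.norm.eventually_lt_const h3] with z hz hz' using ⟨hz, hz'.le⟩

variable {n : ℕ} {Ω U : Set (Rn n)} {F : Rn n → ℝ} {x : Rn n}

theorem eq_zero_of_mem_frontier_of_sublevel (hΩ : IsOpen Ω) (hU : IsOpen U)
    (hF : ContinuousOn F U) (hΩU : Ω ∩ U = {y ∈ U | F y < 0}) (hx : x ∈ frontier Ω)
    (hxU : x ∈ U) : F x = 0 := by
  rw [hΩ.frontier_eq] at hx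
  apply le_antisymm
  · by_contra! h
    have h1 : ∀ᶠ z in 𝓝 x, 0 < F z :=
      (hF.continuousAt (hU.mem_nhds hxU)).eventually_const_lt h
    obtain ⟨z, hz, hzΩ⟩ := mem_closure_iff_nhds.1 hx.1 _ (h1.and (hU.mem_nhds hxU))
    have : z ∈ Ω ∩ U := ⟨hzΩ, hz.2⟩
    rw [hΩU] at this
    exact lt_asymm this.2 hz.1
  · by_contra! h
    have : x ∈ Ω ∩ U := by rw [hΩU]; exact ⟨hxU, h⟩
    exact hx.2 this.1

/-- A zero of `F` outside the closure of `Ω` would be a local minimum of `F`, which the nonvanishing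
differential forbids. -/
theorem mem_frontier_of_sublevel_eq_zero (hΩ : IsOpen Ω) (hU : IsOpen U)
    (hF' : fderiv ℝ F x ≠ 0) (hΩU : Ω ∩ U = {y ∈ U | F y < 0}) (hxU : x ∈ U) (hx : F x = 0) :
    x ∈ frontier Ω := by
  rw [hΩ.frontier_eq]
  refine ⟨?_, fun h => ?_⟩
  · by_contra h
    refine hF' (IsLocalMin.fderiv_eq_zero ?_)
    filter_upwards [isClosed_closure.isOpen_compl.mem_nhds h, hU.mem_nhds hxU] with z hz hzU
    by_contra! hlt
    have : z ∈ Ω ∩ U := by rw [hΩU]; exact ⟨hzU, by linarith⟩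
    exact hz (subset_closure this.1)
  · have : x ∈ Ω ∩ U := ⟨h, hxU⟩
    rw [hΩU] at this
    exact this.2.ne hx

/-- Nearby points of a smooth boundary are joined by short `C¹` curves in the boundary. -/
theorem exists_curve_in_frontier (hΩ : IsOpen Ω) (hs : HasSmoothBoundary Ω) {y : Rn n}
    (hy : y ∈ frontier Ω) :
    ∃ r > 0, ∀ a ∈ frontier Ω ∩ Metric.ball y r, ∀ b ∈ frontier Ω ∩ Metric.ball y r,
      ∃ γ γ' : ℝ → Rn n, γ 0 = a ∧ γ 1 = b ∧ ∀ t ∈ Icc (0 : ℝ) 1,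
        γ t ∈ frontier Ω ∧ HasDerivWithinAt γ (γ' t) (Icc 0 1) t ∧ ‖γ' t‖ ≤ 4 * ‖b - a‖ := by
  obtain ⟨U, hU, hyU, F, hF, hF', hΩU⟩ := hs y hy
  have hFy : ContDiffAt ℝ 1 F y := (hF.contDiffAt (hU.mem_nhds hyU)).of_le (by simp)
  set l := fderiv ℝ F y
  have hFd : HasFDerivAt F l y := (hFy.differentiableAt one_ne_zero).hasFDerivAt
  obtain ⟨w, hw⟩ : ∃ w, l w = 1 := by
    obtain ⟨v, hv⟩ := DFunLike.ne_iff.1 (hF' y hyU)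
    exact ⟨(l v)⁻¹ • v, by rw [map_smul, smul_eq_mul, inv_mul_cancel₀ hv]⟩
  -- A straightening map: the identity plus a second-order correction along `w`, with `l (G x - y) =
  -- F x`. It carries the zero set of `F` into the hyperplane `l (· - y) = 0`, where segments are
  -- available.
  let G : Rn n → Rn n := fun x => x + (F x - l (x - y)) • w
  have hGl (x : Rn n) : l (G x - y) = F x := by
    have : G x - y = (x - y) + (F x - l (x - y)) • w := by simp only [G]; abel
    rw [this, map_add, map_smul, hw, smul_eq_mul, mul_one]; ring
  have hFy0 : F y = 0 := eq_zero_of_mem_frontier_of_sublevel hΩ hU hF.continuousOn hΩU hy hyU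
  have hGy : G y = y := by simp [G, hFy0]
  have hGc : ContDiffAt ℝ 1 G y := by
    have : ContDiffAt ℝ 1 (fun x => l (x - y)) y := by fun_prop
    exact contDiffAt_id.add ((hFy.sub this).smul contDiffAt_const)
  have hGd : HasFDerivAt G (ContinuousLinearMap.id ℝ (Rn n)) y := by
    have h1 : HasFDerivAt (fun x => l (x - y)) l y := by
      exact l.hasFDerivAt.comp y ((hasFDerivAt_id y).sub_const y)
    have h2 := (hasFDerivAt_id (𝕜 := ℝ) y).add ((hFd.sub h1).smul_const w)
    have h3 : ContinuousLinearMap.id ℝ (Rn n) + (l - l).smulRight w =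
        ContinuousLinearMap.id ℝ (Rn n) := by ext; simp
    rw [h3] at h2
    exact h2
  have hGd' : HasFDerivAt G ((ContinuousLinearEquiv.refl ℝ (Rn n) : Rn n ≃L[ℝ] Rn n) :
    Rn n →L[ℝ] Rn n) y := hGd
  let e := hGc.toOpenPartialHomeomorph G hGd' one_ne_zero
  have heG : ∀ x, e x = G x := fun x => rfl
  let P : Rn n → Rn n := e.symm
  have hys : y ∈ e.source := hGc.mem_toOpenPartialHomeomorph_source hGd' one_ne_zero
  have hyt : y ∈ e.target := by
    have := e.map_source hys
    rwa [heG, hGy] at this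
  have hPy : P y = y := by
    have := e.left_inv hys
    rwa [heG, hGy] at this
  have hPc : ContDiffAt ℝ 1 P y := by
    have := hGc.to_localInverse hGd' one_ne_zero
    rwa [hGy] at this
  have hPd : HasFDerivAt P (ContinuousLinearMap.id ℝ (Rn n)) y :=
    e.hasFDerivAt_symm (f' := ContinuousLinearEquiv.refl ℝ (Rn n)) hyt
      (by change HasFDerivAt G _ (P y); rw [hPy]; exact hGd')
  obtain ⟨ρ, hρ, hPρ⟩ := Metric.eventually_nhds_iff_ball.1
    ((exists_ball_norm_fderiv_le_two hPc hPd).and ((e.open_target.eventually_mem hyt).and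
      (hPc.continuousAt.preimage_mem_nhds (by rw [hPy]; exact hU.mem_nhds hyU))))
  obtain ⟨r, hr, hGr⟩ := Metric.eventually_nhds_iff_ball.1
    ((exists_ball_norm_fderiv_le_two hGc hGd).and ((hU.eventually_mem hyU).and
      ((e.open_source.eventually_mem hys).and
      (hGc.continuousAt.preimage_mem_nhds (by rw [hGy]; exact Metric.ball_mem_nhds y hρ)))))
  refine ⟨r, hr, fun a ha b hb => ?_⟩
  have hGab : ‖G b - G a‖ ≤ 2 * ‖b - a‖ :=
    (convex_ball y r).norm_image_sub_le_of_norm_fderiv_le (𝕜 := ℝ) (fun z hz => (hGr z hz).1.1)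
      (fun z hz => (hGr z hz).1.2) ha.2 hb.2
  have hz (t : ℝ) (ht : t ∈ Icc (0 : ℝ) 1) : G a + t • (G b - G a) ∈ Metric.ball y ρ :=
    (convex_ball y ρ).add_smul_sub_mem (hGr a ha.2).2.2.2 (hGr b hb.2).2.2.2 ht
  have hF0 {c : Rn n} (hc : c ∈ frontier Ω ∩ Metric.ball y r) : l (G c - y) = 0 := by
    rw [hGl]
    exact eq_zero_of_mem_frontier_of_sublevel hΩ hU hF.continuousOn hΩU hc.1 (hGr c hc.2).2.1
  -- The curve is the pullback of a straight segment. The speed bound `4 = 2 * 2` comes from the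
  -- derivative bounds of `P` and `G`.
  refine ⟨fun t => P (G a + t • (G b - G a)),
    fun t => fderiv ℝ P (G a + t • (G b - G a)) (G b - G a), ?_, ?_, fun t ht => ⟨?_, ?_, ?_⟩⟩
  · simp only [zero_smul, add_zero]
    exact e.left_inv (hGr a ha.2).2.2.1
  · simp only [one_smul, add_sub_cancel]
    exact e.left_inv (hGr b hb.2).2.2.1
  · obtain ⟨-, hzt, hzU⟩ := hPρ _ (hz t ht)
    refine mem_frontier_of_sublevel_eq_zero hΩ hU (hF' _ hzU) hΩU hzU ?_
    rw [← hGl]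
    have : G (P (G a + t • (G b - G a))) = G a + t • (G b - G a) := e.right_inv hzt
    rw [this]
    have : G a + t • (G b - G a) - y = (1 - t) • (G a - y) + t • (G b - y) := by module
    rw [this, map_add, map_smul, map_smul, hF0 ha, hF0 hb]; simp
  · have h1 : HasDerivAt (fun t : ℝ => G a + t • (G b - G a)) (G b - G a) t := by
      simpa using ((hasDerivAt_id t).smul_const (G b - G a)).const_add (G a)
    exact ((hPρ _ (hz t ht)).1.1.hasFDerivAt.comp_hasDerivAt t h1).hasDerivWithinAt
  · calc _ ≤ ‖fderiv ℝ P (G a + t • (G b - G a))‖ * ‖G b - G a‖ :=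
          ContinuousLinearMap.le_opNorm _ _
      _ ≤ 2 * (2 * ‖b - a‖) := by
          gcongr
          exact (hPρ _ (hz t ht)).1.2
      _ = _ := by ring

/-- A bound for the tangential derivative controls the increments along curves. -/
theorem norm_sub_le_of_curve {M : Set (Rn n)} {f : Rn n → Rn n} (hf : DifferentiableOn ℝ f M)
    {δ B : ℝ} (hδ : 0 ≤ δ) (hfδ : ∀ x ∈ M,
      ‖(fderivWithin ℝ f M x).comp (tangentSubspace M x).subtypeL‖ ≤ δ)
    {γ γ' : ℝ → Rn n} (hγ : ∀ t ∈ Icc (0 : ℝ) 1, γ t ∈ M ∧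
      HasDerivWithinAt γ (γ' t) (Icc 0 1) t ∧ ‖γ' t‖ ≤ B) :
    ‖f (γ 1) - f (γ 0)‖ ≤ δ * B := by
  refine norm_image_sub_le_of_norm_deriv_le_segment_01' (f := fun t => f (γ t))
    (f' := fun t => fderivWithin ℝ f M (γ t) (γ' t)) (fun t ht => ?_) fun t ht => ?_
  · exact (hf _ (hγ t ht).1).hasFDerivWithinAt.comp_hasDerivWithinAt t (hγ t ht).2.1
      fun s hs => (hγ s hs).1
  · obtain ⟨h1, h2, h3⟩ := hγ t (Ico_subset_Icc_self ht)
    have hmem : γ' t ∈ tangentSubspace M (γ t) := by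
      apply Submodule.subset_span
      -- The velocity is tangent to `M` because the derivative of `γ` maps the tangent cone of `[0,
      -- 1]` into that of `M`.
      have h0 : (1 : ℝ) ∈ tangentConeAt ℝ (Icc (0 : ℝ) 1) t := by
        rw [tangentConeAt_eq_univ
          (uniqueDiffOn_Icc one_pos t (Ico_subset_Icc_self ht)).accPt]
        trivial
      have h4 := h2.hasFDerivWithinAt.mapsTo_tangent_cone h0
      simpa using tangentConeAt_mono (image_subset_iff.2 fun s hs => (hγ s hs).1) h4
    have h5 := ((fderivWithin ℝ f M (γ t)).comp
      (tangentSubspace M (γ t)).subtypeL).le_of_opNorm_le (hfδ _ h1) ⟨γ' t, hmem⟩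
    exact h5.trans (by simpa using mul_le_mul_of_nonneg_left h3 hδ)

/-- On a compact smooth boundary, a small `C¹` norm gives a small Lipschitz constant. -/
theorem exists_lipschitz_bound_of_smoothBoundary (hΩ : IsOpen Ω) (hb : Bornology.IsBounded Ω)
    (hs : HasSmoothBoundary Ω) :
    ∃ C > 0, ∀ (f : Rn n → Rn n) (δ : ℝ), DifferentiableOn ℝ f (frontier Ω) →
      (∀ x ∈ frontier Ω, ‖f x‖ ≤ δ) →
      (∀ x ∈ frontier Ω, ‖(fderivWithin ℝ f (frontier Ω) x).comp
        (tangentSubspace (frontier Ω) x).subtypeL‖ ≤ δ) →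
      ∀ a ∈ frontier Ω, ∀ b ∈ frontier Ω, ‖f b - f a‖ ≤ C * δ * ‖b - a‖ := by
  have hM : IsCompact (frontier Ω) :=
    Metric.isCompact_of_isClosed_isBounded isClosed_frontier
      (hb.closure.subset frontier_subset_closure)
  choose! r hr hcurve using fun y (hy : y ∈ frontier Ω) => exists_curve_in_frontier hΩ hs hy
  obtain ⟨η, hη, hball⟩ := lebesgue_number_lemma_of_metric (ι := frontier Ω)
    (c := fun y => Metric.ball y.1 (r y.1)) hM (fun _ => Metric.isOpen_ball)
    fun y hy => mem_iUnion.2 ⟨⟨y, hy⟩, Metric.mem_ball_self (hr y hy)⟩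
  -- `4` serves pairs closer than the Lebesgue number `η`, through curves; `2 / η` serves the
  -- others, through `‖f b - f a‖ ≤ 2 * δ`.
  refine ⟨4 + 2 / η, by positivity, fun f δ hf hf0 hf1 a ha b hb => ?_⟩
  have hδ : 0 ≤ δ := (norm_nonneg _).trans (hf0 a ha)
  rcases lt_or_ge ‖b - a‖ η with h | h
  · obtain ⟨y, hy⟩ := hball a ha
    obtain ⟨γ, γ', rfl, rfl, hγ⟩ := hcurve y.1 y.2 a ⟨ha, hy (Metric.mem_ball_self hη)⟩ b
      ⟨hb, hy (by rwa [mem_ball_iff_norm])⟩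
    refine (norm_sub_le_of_curve hf hδ hf1 hγ).trans ?_
    have : 0 ≤ 2 / η * δ * ‖γ 1 - γ 0‖ := by positivity
    linarith
  · have h1 : ‖f b - f a‖ ≤ 2 * δ := by
      linarith [norm_sub_le (f b) (f a), hf0 a ha, hf0 b hb]
    have h2 : 2 * δ ≤ 2 / η * δ * ‖b - a‖ := by
      calc 2 * δ = 2 / η * δ * η := by field_simp
        _ ≤ _ := by gcongr
    have : 0 ≤ 4 * δ * ‖b - a‖ := by positivity
    linarith

/-! ### Connections to interior balls and invariance of the domain. -/

/-- Near a smooth boundary point, all points of the domain connect to a fixed interior ball. -/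
theorem exists_connected_to_ball_near_frontier (hΩ : IsOpen Ω) (hs : HasSmoothBoundary Ω)
    {y : Rn n} (hy : y ∈ frontier Ω) :
    ∃ ρ > 0, ∀ᶠ x in 𝓝 y, x ∈ Ω → ∃ x', ∃ A ⊆ Ω, IsPreconnected A ∧ x ∈ A ∧ x' ∈ A ∧
      Metric.ball x' ρ ⊆ Ω := by
  obtain ⟨U, hU, hyU, F, hF, hF', hΩU⟩ := hs y hy
  have hFy : ContDiffAt ℝ 1 F y := (hF.contDiffAt (hU.mem_nhds hyU)).of_le (by simp)
  have hFy0 : F y = 0 := eq_zero_of_mem_frontier_of_sublevel hΩ hU hF.continuousOn hΩU hy hyU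
  obtain ⟨w, hw⟩ : ∃ w, fderiv ℝ F y w < 0 := by
    obtain ⟨v, hv⟩ := DFunLike.ne_iff.1 (hF' y hyU)
    rcases lt_or_gt_of_ne hv with h | h
    · exact ⟨v, h⟩
    · exact ⟨-v, by simpa using h⟩
  have hcont : ContinuousAt (fun p : Rn n × Rn n => fderiv ℝ F p.1 p.2) (y, w) := by
    have h1 : ContinuousAt (fderiv ℝ F) y := (hFy.fderiv_right (m := 0) (by simp)).continuousAt
    have h2 : ContinuousAt (fun p : Rn n × Rn n => fderiv ℝ F p.1) (y, w) :=
      ContinuousAt.comp (f := Prod.fst) (x := (y, w)) h1 continuousAt_fst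
    exact h2.clm_apply continuousAt_snd
  have hev := hcont.eventually_lt_const hw
  rw [nhds_prod_eq] at hev
  obtain ⟨p, hp, q, hq, hpq⟩ := eventually_prod_iff.1 hev
  obtain ⟨η, hη, hηp⟩ := Metric.eventually_nhds_iff_ball.1 (hp.and (hU.eventually_mem hyU))
  obtain ⟨θ, hθ, hθq⟩ := Metric.eventually_nhds_iff_ball.1 hq
  obtain ⟨t, ht, htw⟩ : ∃ t : ℝ, 0 < t ∧ y + t • w ∈ Metric.ball y η := by
    have h1 : ContinuousAt (fun t : ℝ => y + t • w) 0 := by fun_prop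
    have h2 := h1.preimage_mem_nhds (t := Metric.ball y η)
      (by simpa using Metric.ball_mem_nhds y hη)
    obtain ⟨t, ht, ht'⟩ := ((eventually_mem_nhdsWithin (a := (0 : ℝ)) (s := Ioi 0)).and
      (nhdsWithin_le_nhds h2)).exists
    exact ⟨t, ht, ht'⟩
  -- If `‖x - y‖ < t * θ`, the direction to `y + t • w`, divided by `t`, is `θ`-close to `w`, so `F`
  -- strictly decreases along the segment. Allowing `F x = 0` lets `x = y` show that the endpoint
  -- lies in `Ω`.
  have hseg : ∀ x ∈ Metric.ball y (min η (t * θ)), F x ≤ 0 → ∀ s ∈ Ioc (0 : ℝ) 1,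
      AffineMap.lineMap x (y + t • w) s ∈ Ω := by
    intro x hx hFx s hs
    rw [Metric.mem_ball, lt_min_iff] at hx
    set v := y + t • w - x with hv
    have hmem : ∀ s ∈ Icc (0 : ℝ) 1, AffineMap.lineMap x (y + t • w) s ∈ Metric.ball y η :=
      fun s hs => (convex_ball y η).lineMap_mem hx.1 htw hs
    have hneg : ∀ z ∈ Metric.ball y η, fderiv ℝ F z v < 0 := by
      intro z hz
      have h1 : t⁻¹ • v ∈ Metric.ball w θ := by
        have : t⁻¹ • v - w = t⁻¹ • (y - x) := by
          rw [hv, show y + t • w - x = (y - x) + t • w by abel, smul_add,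
            inv_smul_smul₀ ht.ne']; abel
        rw [mem_ball_iff_norm, this, norm_smul, norm_inv, Real.norm_of_nonneg ht.le,
          inv_mul_lt_iff₀ ht, ← dist_eq_norm, dist_comm]
        exact hx.2
      have h2 := hpq (hηp z hz).1 (hθq _ h1)
      simp only [map_smul, smul_eq_mul] at h2
      by_contra! h
      exact h2.not_ge (mul_nonneg (inv_pos.2 ht).le h)
    have hd : ∀ s ∈ Icc (0 : ℝ) 1, HasDerivAt (fun s : ℝ => F (AffineMap.lineMap x (y + t • w) s))
        (fderiv ℝ F (AffineMap.lineMap x (y + t • w) s) v) s := by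
      intro s hs
      have h1 : DifferentiableAt ℝ F (AffineMap.lineMap x (y + t • w) s) :=
        (hF.contDiffAt (hU.mem_nhds (hηp _ (hmem s hs)).2)).differentiableAt (by simp)
      exact h1.hasFDerivAt.comp_hasDerivAt s AffineMap.hasDerivAt_lineMap
    have hanti : StrictAntiOn (fun s : ℝ => F (AffineMap.lineMap x (y + t • w) s)) (Icc 0 1) := by
      refine strictAntiOn_of_deriv_neg (convex_Icc 0 1)
        (fun s hs => (hd s hs).continuousAt.continuousWithinAt) fun s hs => ?_
      have hs' := interior_subset hs
      rw [(hd s hs').deriv]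
      exact hneg _ (hmem s hs')
    have hlt := hanti (left_mem_Icc.2 zero_le_one) (Ioc_subset_Icc_self hs) hs.1
    have hsΩ : AffineMap.lineMap x (y + t • w) s ∈ Ω ∩ U := by
      rw [hΩU]
      refine ⟨(hηp _ (hmem s (Ioc_subset_Icc_self hs))).2, ?_⟩
      simp only [AffineMap.lineMap_apply_zero] at hlt
      linarith
    exact hsΩ.1
  have hpos : 0 < min η (t * θ) := lt_min hη (mul_pos ht hθ)
  have hcenter : y + t • w ∈ Ω := by
    simpa using hseg y (Metric.mem_ball_self hpos) hFy0.le 1 (by simp)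
  obtain ⟨ρ, hρ, hρΩ⟩ := Metric.isOpen_iff.1 hΩ _ hcenter
  refine ⟨ρ, hρ, ?_⟩
  filter_upwards [Metric.ball_mem_nhds y hpos, hU.eventually_mem hyU] with x hx hxU hxΩ
  have hFx : F x < 0 := by
    have : x ∈ Ω ∩ U := ⟨hxΩ, hxU⟩
    rw [hΩU] at this
    exact this.2
  refine ⟨y + t • w, segment ℝ x (y + t • w), ?_, (convex_segment _ _).isPreconnected,
    left_mem_segment _ _ _, right_mem_segment _ _ _, hρΩ⟩
  rw [segment_eq_image_lineMap]
  rintro _ ⟨s, hs, rfl⟩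
  rcases hs.1.eq_or_lt with rfl | h
  · simpa using hxΩ
  · exact hseg x hx hFx.le s ⟨h, hs.2⟩

/-- Every point of a bounded smooth domain is connected, inside the domain, to the centre of a ball
of uniform radius. -/
theorem exists_uniform_connected_to_ball (hΩ : IsOpen Ω) (hb : Bornology.IsBounded Ω)
    (hs : HasSmoothBoundary Ω) :
    ∃ ρ > 0, ∀ x ∈ Ω, ∃ x', ∃ A ⊆ Ω, IsPreconnected A ∧ x ∈ A ∧ x' ∈ A ∧
      Metric.ball x' ρ ⊆ Ω := by
  have hc : IsCompact (closure Ω) :=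
    Metric.isCompact_of_isClosed_isBounded isClosed_closure hb.closure
  suffices h : ∃ ρ > 0, ∀ x ∈ closure Ω, x ∈ Ω → ∃ x', ∃ A ⊆ Ω, IsPreconnected A ∧ x ∈ A ∧
      x' ∈ A ∧ Metric.ball x' ρ ⊆ Ω by
    obtain ⟨ρ, hρ, h⟩ := h
    exact ⟨ρ, hρ, fun x hx => h x (subset_closure hx) hx⟩
  refine hc.induction_on (p := fun t => ∃ ρ > 0, ∀ x ∈ t, x ∈ Ω → ∃ x', ∃ A ⊆ Ω,
    IsPreconnected A ∧ x ∈ A ∧ x' ∈ A ∧ Metric.ball x' ρ ⊆ Ω) ⟨1, one_pos, by simp⟩ ?_ ?_ ?_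
  · rintro s t hst ⟨ρ, hρ, h⟩
    exact ⟨ρ, hρ, fun x hx => h x (hst hx)⟩
  · rintro s t ⟨ρ, hρ, h⟩ ⟨ρ', hρ', h'⟩
    refine ⟨min ρ ρ', lt_min hρ hρ', fun x hx hxΩ => ?_⟩
    rcases hx with hx | hx
    · obtain ⟨x', A, hA, h1, h2, h3, h4⟩ := h x hx hxΩ
      exact ⟨x', A, hA, h1, h2, h3, (Metric.ball_subset_ball (min_le_left _ _)).trans h4⟩
    · obtain ⟨x', A, hA, h1, h2, h3, h4⟩ := h' x hx hxΩ
      exact ⟨x', A, hA, h1, h2, h3, (Metric.ball_subset_ball (min_le_right _ _)).trans h4⟩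
  · intro x hx
    by_cases hxΩ : x ∈ Ω
    · obtain ⟨ρ, hρ, hρΩ⟩ := Metric.isOpen_iff.1 hΩ x hxΩ
      refine ⟨_, mem_nhdsWithin_of_mem_nhds (Metric.ball_mem_nhds x (half_pos hρ)), ρ / 2,
        half_pos hρ, fun z hz hzΩ => ⟨z, {z}, by simpa using hzΩ, isPreconnected_singleton,
          rfl, rfl, ?_⟩⟩
      refine (Metric.ball_subset_ball' ?_).trans hρΩ
      linarith [Metric.mem_ball.1 hz]
    · have hfr : x ∈ frontier Ω := by rw [hΩ.frontier_eq]; exact ⟨hx, hxΩ⟩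
      obtain ⟨ρ, hρ, h⟩ := exists_connected_to_ball_near_frontier hΩ hs hfr
      exact ⟨_, mem_nhdsWithin_of_mem_nhds h, ρ, hρ, fun z hz hzΩ => hz hzΩ⟩

/-- A continuous map that is close to the identity and maps no point of `Ω` to `∂Ω` maps `Ω` to
itself. -/
theorem mapsTo_of_dist_lt {E : Type*} [PseudoMetricSpace E] {Ω : Set E} (hΩ : IsOpen Ω) {ρ : ℝ}
    (hρ : ∀ x ∈ Ω, ∃ x', ∃ A ⊆ Ω, IsPreconnected A ∧ x ∈ A ∧ x' ∈ A ∧ Metric.ball x' ρ ⊆ Ω)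
    {Φ : E → E} (hΦ : Continuous Φ) (hΦd : ∀ x ∈ Ω, dist (Φ x) x < ρ)
    (hΦf : ∀ x ∈ Ω, Φ x ∉ frontier Ω) : MapsTo Φ Ω Ω := by
  intro x hx
  obtain ⟨x', A, hA, hpre, hxA, hx'A, hball⟩ := hρ x hx
  -- The image of `A` misses `∂Ω`, so `Ω` is relatively clopen in it; it meets `Ω` at `Φ x'`.
  refine (hpre.image Φ hΦ.continuousOn).subset_of_closure_inter_subset hΩ
    ⟨Φ x', mem_image_of_mem Φ hx'A, hball (hΦd x' (hA hx'A))⟩ ?_ (mem_image_of_mem Φ hxA)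
  rintro _ ⟨hz, a, ha, rfl⟩
  by_contra h
  exact hΦf a (hA ha) (by rw [hΩ.frontier_eq]; exact ⟨hz, h⟩)

end Boundary

/-! ### Compactly supported Lipschitz functions in `H¹₀`. -/

section LipschitzSobolev

open Filter Topology
open scoped NNReal Convolution

theorem eLpNorm_two_eq_rpow {α E : Type*} [MeasurableSpace α] [NormedAddCommGroup E]
    {μ : Measure α} (f : α → E) :
    eLpNorm f 2 μ = (∫⁻ x, ‖f x‖ₑ ^ 2 ∂μ) ^ (1 / 2 : ℝ) := by
  rw [eLpNorm_eq_lintegral_rpow_enorm_toReal (by simp) (by simp)]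
  simp

/-- Bounded convergence in `L²` on a space of finite measure. -/
theorem tendsto_eLpNorm_two_of_bounded {α E : Type*} [MeasurableSpace α] [NormedAddCommGroup E]
    {μ : Measure α} [IsFiniteMeasure μ] {f : ℕ → α → E}
    (hf : ∀ k, AEStronglyMeasurable (f k) μ) {C : ℝ} (hC : ∀ k x, ‖f k x‖ ≤ C)
    (h : ∀ᵐ x ∂μ, Tendsto (fun k => f k x) atTop (𝓝 0)) :
    Tendsto (fun k => eLpNorm (f k) 2 μ) atTop (𝓝 0) := by
  simp_rw [eLpNorm_two_eq_rpow]
  have h1 : Tendsto (fun k => ∫⁻ x, ‖f k x‖ₑ ^ 2 ∂μ) atTop (𝓝 (∫⁻ _, 0 ∂μ)) := by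
    refine tendsto_lintegral_of_dominated_convergence' (fun _ => ENNReal.ofReal C ^ 2)
      (fun k => (hf k).enorm.pow_const 2) (fun k => ae_of_all _ fun x => ?_) ?_ ?_
    · dsimp only
      gcongr
      rw [← ofReal_norm]
      exact ENNReal.ofReal_le_ofReal (hC k x)
    · rw [lintegral_const]
      exact ENNReal.mul_ne_top (by simp) (measure_ne_top _ _)
    · filter_upwards [h] with x hx
      have := (ENNReal.continuous_pow 2).tendsto 0 |>.comp (by simpa using hx.enorm)
      simpa [Function.comp_def] using this
  rw [lintegral_zero] at h1
  have := (ENNReal.continuous_rpow_const (y := 1 / 2)).tendsto 0 |>.comp h1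
  simpa [Function.comp_def] using this

variable {n : ℕ} {Ω : Set (Rn n)} {v ψ : Rn n → ℝ} {K : ℝ≥0}

theorem measurable_gradient (v : Rn n → ℝ) : Measurable (gradient v) :=
  (InnerProductSpace.toDual ℝ (Rn n)).symm.continuous.measurable.comp (measurable_fderiv ℝ v)

theorem norm_gradient (v : Rn n → ℝ) (x : Rn n) : ‖gradient v x‖ = ‖fderiv ℝ v x‖ := by
  rw [← toDual_gradient, LinearIsometryEquiv.norm_map]

theorem LipschitzWith.norm_gradient_le (hv : LipschitzWith K v) (x : Rn n) :
    ‖gradient v x‖ ≤ K := by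
  rw [norm_gradient]
  exact norm_fderiv_le_of_lipschitz ℝ hv

theorem support_gradient_subset (v : Rn n → ℝ) : Function.support (gradient v) ⊆ tsupport v := by
  refine Subset.trans (fun x hx => ?_) (support_fderiv_subset ℝ)
  rw [Function.mem_support, ← norm_ne_zero_iff, norm_gradient] at hx
  rwa [Function.mem_support, ← norm_ne_zero_iff]

theorem LipschitzWith.ae_lineDeriv_eq_inner_gradient (hv : LipschitzWith K v) (e : Rn n) :
    ∀ᵐ x, lineDeriv ℝ v x e = inner ℝ (gradient v x) e := by
  filter_upwards [hv.ae_differentiableAt] with x hx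
  rw [hx.lineDeriv_eq_fderiv, inner_gradient_left]

theorem lineDeriv_eq_inner_gradient (hψ : ContDiff ℝ ∞ ψ) (x e : Rn n) :
    lineDeriv ℝ ψ x e = inner ℝ (gradient ψ x) e := by
  rw [(hψ.differentiable (by simp) x).lineDeriv_eq_fderiv, inner_gradient_left]

theorem continuous_gradient (hψ : ContDiff ℝ ∞ ψ) : Continuous (gradient ψ) :=
  (InnerProductSpace.toDual ℝ (Rn n)).symm.continuous.comp (hψ.continuous_fderiv (by simp))

theorem hasCompactSupport_gradient (hc : HasCompactSupport ψ) : HasCompactSupport (gradient ψ) :=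
  hc.mono' (support_gradient_subset ψ)

theorem LipschitzWith.integrable_smul_gradient (hv : LipschitzWith K v) (hψ : Continuous ψ)
    (hc : HasCompactSupport ψ) : Integrable fun x => ψ x • gradient v x :=
  (hψ.integrable_of_hasCompactSupport hc).smul_bdd K
    (measurable_gradient v).aestronglyMeasurable (ae_of_all _ hv.norm_gradient_le)

theorem LipschitzWith.locallyIntegrable_gradient (hv : LipschitzWith K v) :
    LocallyIntegrable (gradient v) volume :=
  (memLp_top_of_bound (measurable_gradient v).aestronglyMeasurable K
    (ae_of_all _ hv.norm_gradient_le)).locallyIntegrable le_top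

/-- By Rademacher's theorem the pointwise gradient exists almost everywhere; integration by parts
for Lipschitz functions, one direction at a time, makes it the weak gradient. -/
theorem LipschitzWith.isWeakGradient (hv : LipschitzWith K v) :
    IsWeakGradient Ω v (gradient v) := by
  intro ψ hψ
  obtain ⟨D, hD⟩ := (hψ.smooth.of_le (by simp)).lipschitzWith_of_hasCompactSupport
    hψ.hasCompactSupport one_ne_zero
  have h0 : ∀ x, x ∉ Ω → ψ x = 0 := fun x hx =>
    image_eq_zero_of_notMem_tsupport fun h => hx (hψ.tsupport_subset h)
  have h0' : ∀ x, x ∉ Ω → gradient ψ x = 0 := fun x hx =>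
    Function.notMem_support.1 fun h => hx (hψ.tsupport_subset (support_gradient_subset ψ h))
  rw [setIntegral_eq_integral_of_forall_compl_eq_zero fun x hx => by rw [h0' x hx, smul_zero],
    setIntegral_eq_integral_of_forall_compl_eq_zero fun x hx => by rw [h0 x hx, zero_smul]]
  have hi1 : Integrable fun x => v x • gradient ψ x :=
    (hv.continuous.smul (continuous_gradient hψ.smooth)).integrable_of_hasCompactSupport
      (hasCompactSupport_gradient hψ.hasCompactSupport).smul_left
  have hi2 := hv.integrable_smul_gradient hψ.smooth.continuous hψ.hasCompactSupport
  refine ext_inner_left ℝ fun e => ?_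
  rw [inner_neg_right, ← integral_inner hi1, ← integral_inner hi2, ← integral_neg]
  have h := hv.integral_lineDeriv_mul_eq (μ := volume) hD hψ.hasCompactSupport e
  have h1 : ∫ x, lineDeriv ℝ v x e * ψ x = ∫ x, inner ℝ e (ψ x • gradient v x) := by
    refine integral_congr_ae ?_
    filter_upwards [hv.ae_lineDeriv_eq_inner_gradient e] with x hx
    rw [hx, real_inner_smul_right, real_inner_comm, mul_comm]
  have h2 : ∫ x, lineDeriv ℝ ψ x (-e) * v x = ∫ x, -inner ℝ e (v x • gradient ψ x) := by
    refine integral_congr_ae (ae_of_all _ fun x => ?_)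
    simp only
    rw [lineDeriv_eq_inner_gradient hψ.smooth, real_inner_smul_right, inner_neg_right,
      real_inner_comm]
    ring
  rw [integral_neg, ← h1, h, h2, integral_neg, neg_neg]

/-- The gradient of a mollified Lipschitz function is the mollified gradient. -/
theorem LipschitzWith.gradient_convolution (hv : LipschitzWith K v) (hψ : ContDiff ℝ ∞ ψ)
    (hc : HasCompactSupport ψ) (x : Rn n) :
    gradient (ψ ⋆[ContinuousLinearMap.lsmul ℝ ℝ, volume] v) x =
      (ψ ⋆[ContinuousLinearMap.lsmul ℝ ℝ, volume] (gradient v)) x := by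
  have hψ1 : ContDiff ℝ 1 ψ := hψ.of_le (by simp)
  obtain ⟨D, hD⟩ := hψ1.lipschitzWith_of_hasCompactSupport hc one_ne_zero
  have hf := (HasCompactSupport.hasFDerivAt_convolution_left
    (ContinuousLinearMap.lsmul ℝ ℝ : ℝ →L[ℝ] ℝ →L[ℝ] ℝ) hc hψ1
    (hv.continuous.locallyIntegrable (μ := volume)) x)
  have hex : ConvolutionExistsAt (fderiv ℝ ψ) v x
      ((ContinuousLinearMap.lsmul ℝ ℝ : ℝ →L[ℝ] ℝ →L[ℝ] ℝ).precompL (Rn n)) volume :=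
    (hc.fderiv ℝ).convolutionExists_left _ (hψ.continuous_fderiv (by simp))
      hv.continuous.locallyIntegrable x
  have hloc : LocallyIntegrable (gradient v) volume :=
    hv.locallyIntegrable_gradient
  have hex2 : ConvolutionExistsAt ψ (gradient v) x (ContinuousLinearMap.lsmul ℝ ℝ) volume :=
    hc.convolutionExists_left _ hψ.continuous hloc x
  refine ext_inner_right ℝ fun e => ?_
  rw [inner_gradient_left, hf.fderiv, convolution_def, convolution_def,
    ContinuousLinearMap.integral_apply hex, real_inner_comm, ← integral_inner hex2]
  have hvx : LipschitzWith K fun t => v (x - t) := by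
    have h1 : LipschitzWith 1 fun t => x - t := LipschitzWith.mk_one fun a b => by
      rw [dist_sub_left]
    simpa [Function.comp_def] using hv.comp h1
  -- The reflection `t ↦ x - t` turns the derivative in direction `-e` into that of `v` in direction
  -- `e`, so the derivative moves from `ψ` to `v` without a sign.
  have h := hvx.integral_lineDeriv_mul_eq (μ := volume) hD hc (-e)
  have hl (t : Rn n) : lineDeriv ℝ (fun t => v (x - t)) t (-e) = lineDeriv ℝ v (x - t) e := by
    simp only [lineDeriv]
    congr 1 with s
    congr 1
    module
  simp only [hl, neg_neg] at h
  have h1 : ∫ t, ((ContinuousLinearMap.lsmul ℝ ℝ : ℝ →L[ℝ] ℝ →L[ℝ] ℝ).precompL (Rn n)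
      (fderiv ℝ ψ t) (v (x - t))) e = ∫ t, lineDeriv ℝ ψ t e * v (x - t) := by
    refine integral_congr_ae (ae_of_all _ fun t => ?_)
    simp [(hψ1.differentiable one_ne_zero t).lineDeriv_eq_fderiv]
  rw [h1, ← h]
  refine integral_congr_ae ?_
  filter_upwards [(Measure.measurePreserving_sub_left volume x).quasiMeasurePreserving.ae
    (hv.ae_lineDeriv_eq_inner_gradient e)] with t ht
  rw [ht, ContinuousLinearMap.lsmul_apply, real_inner_smul_right, real_inner_comm, mul_comm]

theorem norm_normed_convolution_le {E : Type*} [NormedAddCommGroup E] [NormedSpace ℝ E]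
    (φ : ContDiffBump (0 : Rn n)) {g : Rn n → E} {C : ℝ} (hC : ∀ x, ‖g x‖ ≤ C) (x : Rn n) :
    ‖(φ.normed volume ⋆[ContinuousLinearMap.lsmul ℝ ℝ, volume] g) x‖ ≤ C := by
  calc _ ≤ ∫ t, φ.normed volume t * C := by
        refine norm_integral_le_of_norm_le (φ.integrable_normed.mul_const C)
          (ae_of_all _ fun t => ?_)
        rw [ContinuousLinearMap.lsmul_apply, norm_smul,
          Real.norm_of_nonneg (φ.nonneg_normed t)]
        exact mul_le_mul_of_nonneg_left (hC _) (φ.nonneg_normed t)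
    _ = C := by rw [integral_mul_const, φ.integral_normed, one_mul]

/-- Bump functions with supports shrinking to the origin. -/
noncomputable def shrinkingBump (n : ℕ) (δ : ℝ) (hδ : 0 < δ) (k : ℕ) : ContDiffBump (0 : Rn n) where
  rIn := δ / 2 / (k + 1)
  rOut := δ / (k + 1)
  rIn_pos := by positivity
  rIn_lt_rOut := by gcongr; linarith

/-- Compactly supported Lipschitz functions are approximated in `H¹` by test functions. -/
theorem LipschitzWith.exists_testFunction_approx (hΩ : IsOpen Ω) (hb : Bornology.IsBounded Ω)
    (hv : LipschitzWith K v) (hc : HasCompactSupport v) (hsub : tsupport v ⊆ Ω) {δ : ℝ≥0∞}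
    (hδ : 0 < δ) : ∃ ψ : Rn n → ℝ, IsTestFunction Ω ψ ∧
      eLpNorm (fun x => v x - ψ x) 2 (volume.restrict Ω) < δ ∧
      eLpNorm (fun x => gradient v x - gradient ψ x) 2 (volume.restrict Ω) < δ := by
  have : IsFiniteMeasure (volume.restrict Ω) := ⟨by simpa using hb.measure_lt_top⟩
  obtain ⟨r, hr, hrΩ⟩ := hc.isCompact.exists_cthickening_subset_open hΩ hsub
  obtain ⟨C, hC⟩ := hv.continuous.bounded_above_of_compact_support hc
  let φ := shrinkingBump n r hr
  let V : ℕ → Rn n → ℝ :=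
    fun k => (φ k).normed volume ⋆[ContinuousLinearMap.lsmul ℝ ℝ, volume] v
  have hφ0 : Tendsto (fun k => (φ k).rOut) atTop (𝓝 0) := by
    change Tendsto (fun k : ℕ => r / ((k : ℝ) + 1)) atTop (𝓝 0)
    exact tendsto_const_nhds.div_atTop
      (tendsto_atTop_add_const_right _ _ tendsto_natCast_atTop_atTop)
  -- A bounded ratio of radii is what gives almost everywhere convergence of the mollified gradient,
  -- which need not be continuous.
  have hφK : ∀ᶠ k in atTop, (φ k).rOut ≤ 2 * (φ k).rIn := Eventually.of_forall fun k => by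
    change r / ((k : ℝ) + 1) ≤ 2 * (r / 2 / ((k : ℝ) + 1))
    apply le_of_eq; ring
  have hφr (k : ℕ) : (φ k).rOut ≤ r := by
    change r / ((k : ℝ) + 1) ≤ r
    exact div_le_self hr.le (by simp)
  have hVs (k : ℕ) : ContDiff ℝ ∞ (V k) :=
    (φ k).hasCompactSupport_normed.contDiff_convolution_left _ (φ k).contDiff_normed
      hv.continuous.locallyIntegrable
  have hVt (k : ℕ) : IsTestFunction Ω (V k) := by
    refine ⟨hVs k, (φ k).hasCompactSupport_normed.convolution _ hc, ?_⟩
    refine (closure_minimal ?_ Metric.isClosed_cthickening).trans hrΩ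
    refine (support_convolution_subset _).trans ?_
    rintro _ ⟨a, ha, b, hb', rfl⟩
    rw [(φ k).support_normed_eq] at ha
    refine Metric.mem_cthickening_of_dist_le _ b _ _ (subset_tsupport v hb') ?_
    simpa [dist_eq_norm] using (mem_ball_zero_iff.1 ha).le.trans (hφr k)
  have hVg (k : ℕ) (x : Rn n) : gradient (V k) x =
      ((φ k).normed volume ⋆[ContinuousLinearMap.lsmul ℝ ℝ, volume] (gradient v)) x :=
    hv.gradient_convolution (φ k).contDiff_normed (φ k).hasCompactSupport_normed x
  have h1 : Tendsto (fun k => eLpNorm (fun x => v x - V k x) 2 (volume.restrict Ω)) atTop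
      (𝓝 0) := by
    refine tendsto_eLpNorm_two_of_bounded (C := C + C)
      (fun k => (hv.continuous.sub (hVs k).continuous).aestronglyMeasurable)
      (fun k x => (_root_.norm_sub_le _ _).trans
        (add_le_add (hC x) (norm_normed_convolution_le (φ k) hC x)))
      (ae_restrict_of_ae (ae_of_all _ fun x => ?_))
    simpa using (ContDiffBump.convolution_tendsto_right_of_continuous (μ := volume) hφ0
      hv.continuous x).const_sub (v x)
  have h2 : Tendsto (fun k => eLpNorm (fun x => gradient v x - gradient (V k) x) 2
      (volume.restrict Ω)) atTop (𝓝 0) := by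
    refine tendsto_eLpNorm_two_of_bounded (C := K + K)
      (fun k => ((measurable_gradient v).sub (measurable_gradient _)).aestronglyMeasurable)
      (fun k x => (_root_.norm_sub_le _ _).trans (add_le_add (hv.norm_gradient_le x) ?_))
      (ae_restrict_of_ae ?_)
    · rw [hVg]
      exact norm_normed_convolution_le (φ k) hv.norm_gradient_le x
    · filter_upwards [ContDiffBump.ae_convolution_tendsto_right_of_locallyIntegrable (μ := volume)
        hφ0 hφK hv.locallyIntegrable_gradient] with x hx
      simp_rw [hVg]
      simpa using hx.const_sub (gradient v x)
  obtain ⟨k, hk1, hk2⟩ :=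
    ((h1.eventually_lt_const hδ).and (h2.eventually_lt_const hδ)).exists
  exact ⟨V k, hVt k, hk1, hk2⟩

/-- Compactly supported Lipschitz functions belong to `H¹₀`. -/
theorem LipschitzWith.memH10 (hΩ : IsOpen Ω) (hb : Bornology.IsBounded Ω)
    (hv : LipschitzWith K v) (hc : HasCompactSupport v) (hsub : tsupport v ⊆ Ω) :
    MemH10 Ω v (gradient v) := by
  have : IsFiniteMeasure (volume.restrict Ω) := ⟨by simpa using hb.measure_lt_top⟩
  obtain ⟨C, hC⟩ := hv.continuous.bounded_above_of_compact_support hc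
  exact
    { memLp := MemLp.of_bound hv.continuous.aestronglyMeasurable C (ae_of_all _ hC)
      memLp_grad := MemLp.of_bound (measurable_gradient v).aestronglyMeasurable K
        (ae_of_all _ hv.norm_gradient_le)
      isWeakGradient := hv.isWeakGradient
      approx := fun δ hδ => hv.exists_testFunction_approx hΩ hb hc hsub hδ }

theorem IsTestFunction.exists_lipschitzWith (hψ : IsTestFunction Ω ψ) :
    ∃ D, LipschitzWith D ψ :=
  (hψ.smooth.of_le (by simp)).lipschitzWith_of_hasCompactSupport hψ.hasCompactSupport
    (n := 1) one_ne_zero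

end LipschitzSobolev

/-! ### Hardy inequalities and their reduction to test functions. -/

section HardyConstant

open Filter Topology
open scoped NNReal

variable {n : ℕ} {Ω S : Set (Rn n)} {u : Rn n → ℝ} {g : Rn n → Rn n}

theorem hardyConstant_mul_le (hu : MemH10 Ω u g) :
    hardyConstant Ω S * ∫⁻ x in Ω, ‖u x‖ₑ ^ 2 / Metric.infEDist x S ^ 2 ≤
      ∫⁻ x in Ω, ‖g x‖ₑ ^ 2 := by
  by_cases h0 : u =ᵐ[volume.restrict Ω] 0
  · have : ∫⁻ x in Ω, ‖u x‖ₑ ^ 2 / Metric.infEDist x S ^ 2 = 0 := by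
      rw [← lintegral_zero (μ := volume.restrict Ω)]
      refine lintegral_congr_ae ?_
      filter_upwards [h0] with x hx
      simp [hx]
    rw [this, mul_zero]
    exact zero_le
  · refine ENNReal.mul_le_of_le_div ?_
    exact iInf_le_of_le u (iInf_le_of_le g (iInf_le_of_le hu (iInf_le_of_le h0 le_rfl)))

theorem lintegral_enorm_sq_eq (h : Rn n → Rn n) :
    ∫⁻ x in Ω, ‖h x‖ₑ ^ 2 = eLpNorm h 2 (volume.restrict Ω) ^ 2 := by
  rw [eLpNorm_two_eq_rpow, ← ENNReal.rpow_natCast, ← ENNReal.rpow_mul]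
  simp

theorem infEDist_ne_zero_of_mem (hΩ : IsOpen Ω) (hS : S ⊆ frontier Ω) {x : Rn n} (hx : x ∈ Ω) :
    Metric.infEDist x S ≠ 0 := by
  rw [Ne, ← Metric.mem_closure_iff_infEDist_zero]
  intro h
  have h1 := closure_minimal hS isClosed_frontier h
  rw [hΩ.frontier_eq] at h1
  exact h1.2 hx

theorem lintegral_hardy_weight_ne_zero (hSne : S.Nonempty)
    (hu : AEStronglyMeasurable u (volume.restrict Ω)) (h0 : ¬ u =ᵐ[volume.restrict Ω] 0) :
    ∫⁻ x in Ω, ‖u x‖ₑ ^ 2 / Metric.infEDist x S ^ 2 ≠ 0 := by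
  intro h
  have hm : AEMeasurable (fun x => ‖u x‖ₑ ^ 2 / Metric.infEDist x S ^ 2) (volume.restrict Ω) :=
    (hu.enorm.pow_const 2).div (Metric.continuous_infEDist.measurable.pow_const 2).aemeasurable
  rw [lintegral_eq_zero_iff' hm] at h
  refine h0 ?_
  filter_upwards [h] with x hx
  have h1 : Metric.infEDist x S ^ 2 ≠ ⊤ := by simp [Metric.infEDist_ne_top hSne]
  simpa [ENNReal.div_eq_zero_iff, h1] using hx

/-- A Hardy inequality for test functions extends to `H¹₀`. -/
theorem mul_lintegral_le_of_testFunction (hΩ : IsOpen Ω) (hS : S ⊆ frontier Ω) {b : ℝ≥0∞}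
    (hb : b ≠ ⊤) (h : ∀ ψ, IsTestFunction Ω ψ →
      b * ∫⁻ x in Ω, ‖ψ x‖ₑ ^ 2 / Metric.infEDist x S ^ 2 ≤ ∫⁻ x in Ω, ‖gradient ψ x‖ₑ ^ 2)
    (hu : MemH10 Ω u g) :
    b * ∫⁻ x in Ω, ‖u x‖ₑ ^ 2 / Metric.infEDist x S ^ 2 ≤ ∫⁻ x in Ω, ‖g x‖ₑ ^ 2 := by
  have hδ (k : ℕ) : (0 : ℝ≥0∞) < ((k : ℝ≥0∞) + 1)⁻¹ := by simp
  choose ψ hψ hψu hψg using fun k : ℕ => hu.approx _ (hδ k)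
  have hlim : Tendsto (fun k : ℕ => ((k : ℝ≥0∞) + 1)⁻¹) atTop (𝓝 0) := by
    simpa [Function.comp_def] using ENNReal.tendsto_inv_nat_nhds_zero.comp (tendsto_add_atTop_nat 1)
  have hψm (k : ℕ) : AEStronglyMeasurable (ψ k) (volume.restrict Ω) :=
    (hψ k).smooth.continuous.aestronglyMeasurable
  have h1 : Tendsto (fun k => eLpNorm (ψ k - u) 2 (volume.restrict Ω)) atTop (𝓝 0) := by
    refine tendsto_of_tendsto_of_tendsto_of_le_of_le tendsto_const_nhds hlim
      (fun _ => zero_le) fun k => ?_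
    rw [eLpNorm_sub_comm]
    exact (hψu k).le
  obtain ⟨ns, hns, hae⟩ := (tendstoInMeasure_of_tendsto_eLpNorm (by simp) hψm
    hu.memLp.aestronglyMeasurable h1).exists_seq_tendsto_ae
  have hwm : Measurable fun x : Rn n => Metric.infEDist x S ^ 2 :=
    Metric.continuous_infEDist.measurable.pow_const 2
  set N := eLpNorm g 2 (volume.restrict Ω) with hN
  rw [lintegral_enorm_sq_eq, ← lintegral_const_mul' _ _ hb]
  -- Fatou's lemma along an almost everywhere convergent subsequence. The weight is finite inside
  -- `Ω`, so the integrands converge pointwise although the weight may be unbounded.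
  calc ∫⁻ x in Ω, b * (‖u x‖ₑ ^ 2 / Metric.infEDist x S ^ 2)
      = ∫⁻ x in Ω, liminf (fun k => b * (‖ψ (ns k) x‖ₑ ^ 2 / Metric.infEDist x S ^ 2)) atTop := by
        refine lintegral_congr_ae ?_
        filter_upwards [hae, ae_restrict_mem hΩ.measurableSet] with x hx hxΩ
        refine (Tendsto.liminf_eq ?_).symm
        refine ENNReal.Tendsto.const_mul ?_ (Or.inr hb)
        refine ENNReal.Tendsto.div_const ?_
          (Or.inr (pow_ne_zero 2 (infEDist_ne_zero_of_mem hΩ hS hxΩ)))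
        exact ((ENNReal.continuous_pow 2).tendsto _).comp hx.enorm
    _ ≤ liminf (fun k => ∫⁻ x in Ω, b * (‖ψ (ns k) x‖ₑ ^ 2 / Metric.infEDist x S ^ 2)) atTop :=
        lintegral_liminf_le' fun k => (((hψm _).enorm.pow_const 2).div
          hwm.aemeasurable).const_mul b
    _ ≤ liminf (fun k => (N + ((ns k : ℝ≥0∞) + 1)⁻¹) ^ 2) atTop := by
        refine liminf_le_liminf (Eventually.of_forall fun k => ?_)
        rw [lintegral_const_mul' _ _ hb]
        refine (h _ (hψ _)).trans ?_
        rw [lintegral_enorm_sq_eq]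
        gcongr
        have hgm : AEStronglyMeasurable (gradient (ψ (ns k))) (volume.restrict Ω) :=
          (measurable_gradient _).aestronglyMeasurable
        calc eLpNorm (gradient (ψ (ns k))) 2 (volume.restrict Ω)
            = eLpNorm (g - (g - gradient (ψ (ns k)))) 2 (volume.restrict Ω) := by
              rw [sub_sub_cancel]
          _ ≤ N + eLpNorm (g - gradient (ψ (ns k))) 2 (volume.restrict Ω) :=
              eLpNorm_sub_le hu.memLp_grad.aestronglyMeasurable
                (hu.memLp_grad.aestronglyMeasurable.sub hgm) (by simp)
          _ ≤ _ := by gcongr; exact (hψg (ns k)).le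
    _ = N ^ 2 := by
        refine Tendsto.liminf_eq ?_
        have := (hlim.comp hns.tendsto_atTop).const_add N
        rw [add_zero] at this
        exact ((ENNReal.continuous_pow 2).tendsto _).comp this

theorem le_hardyConstant_of_testFunction (hΩ : IsOpen Ω) (hS : S ⊆ frontier Ω) (hSne : S.Nonempty)
    {b : ℝ≥0∞} (hb : b ≠ ⊤) (h : ∀ ψ, IsTestFunction Ω ψ →
      b * ∫⁻ x in Ω, ‖ψ x‖ₑ ^ 2 / Metric.infEDist x S ^ 2 ≤ ∫⁻ x in Ω, ‖gradient ψ x‖ₑ ^ 2) :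
    b ≤ hardyConstant Ω S := by
  refine le_iInf fun u => le_iInf fun g => le_iInf fun hu => le_iInf fun h0 => ?_
  have hnum : ∫⁻ x in Ω, ‖g x‖ₑ ^ 2 ≠ ⊤ := by
    rw [lintegral_enorm_sq_eq]
    exact ENNReal.pow_ne_top hu.memLp_grad.eLpNorm_ne_top
  rw [hardyQuotient, ENNReal.le_div_iff_mul_le
    (Or.inl (lintegral_hardy_weight_ne_zero hSne hu.memLp.aestronglyMeasurable h0)) (Or.inr hnum)]
  exact mul_lintegral_le_of_testFunction hΩ hS hb h hu

/-- A single bump function suffices: its energy is finite and its weighted norm is nonzero. -/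
theorem hardyConstant_ne_top (hΩ : IsOpen Ω) (hb : Bornology.IsBounded Ω) (hΩne : Ω.Nonempty)
    (hSne : S.Nonempty) : hardyConstant Ω S ≠ ⊤ := by
  obtain ⟨x, hx⟩ := hΩne
  obtain ⟨ψ, hψs, hψc, hψd, -, hψx⟩ :=
    exists_contDiff_tsupport_subset (n := (⊤ : ℕ∞)) (hΩ.mem_nhds hx)
  have hψ : IsTestFunction Ω ψ := ⟨hψd, hψc, hψs⟩
  obtain ⟨D, hD⟩ := hψ.exists_lipschitzWith
  have hmem := hD.memH10 hΩ hb hψc hψs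
  have h0 : ¬ ψ =ᵐ[volume.restrict Ω] 0 := by
    intro h
    have := (Measure.eqOn_open_of_ae_eq h hΩ hψd.continuous.continuousOn continuousOn_const) hx
    simp [hψx] at this
  intro htop
  have hle := hardyConstant_mul_le (S := S) hmem
  rw [htop, ENNReal.top_mul
    (lintegral_hardy_weight_ne_zero hSne hmem.memLp.aestronglyMeasurable h0), top_le_iff,
    lintegral_enorm_sq_eq] at hle
  exact ENNReal.pow_ne_top hmem.memLp_grad.eLpNorm_ne_top hle

/-! ### Bi-Lipschitz changes of variables. -/

theorem LipschitzWith.volume_image_le {K : ℝ≥0} {f : Rn n → Rn n} (hf : LipschitzWith K f)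
    (s : Set (Rn n)) : volume (f '' s) ≤ (K : ℝ≥0∞) ^ n * volume s := by
  -- By uniqueness of Haar measure, volume is a multiple of Hausdorff measure, whose Lipschitz
  -- scaling is known.
  have : (μH[(n : ℝ)] : Measure (Rn n)).IsAddHaarMeasure := by
    simpa using isAddHaarMeasure_hausdorffMeasure (E := Rn n)
  rw [Measure.isAddLeftInvariant_eq_smul (volume : Measure (Rn n)) μH[(n : ℝ)],
    Measure.smul_apply, Measure.smul_apply, mul_smul_comm]
  gcongr
  simpa using hf.hausdorffMeasure_image_le (d := n) (by positivity) s

theorem lintegral_comp_homeomorph_le {K : ℝ≥0} (Φ : Rn n ≃ₜ Rn n) (hΦ : LipschitzWith K Φ.symm)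
    (hΩm : MeasurableSet Ω) (hΦΩ : ∀ x, Φ x ∈ Ω ↔ x ∈ Ω) (h : Rn n → ℝ≥0∞) :
    ∫⁻ x in Ω, h (Φ x) ≤ (K : ℝ≥0∞) ^ n * ∫⁻ x in Ω, h x := by
  have hle : volume.map Φ.toMeasurableEquiv ≤ (K : ℝ≥0∞) ^ n • (volume : Measure (Rn n)) := by
    refine Measure.le_iff.2 fun s hs => ?_
    rw [MeasurableEquiv.map_apply, Measure.smul_apply, smul_eq_mul]
    have : Φ.toMeasurableEquiv ⁻¹' s = Φ.symm '' s := (Φ.symm.image_eq_preimage_symm s).symm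
    rw [this]
    exact hΦ.volume_image_le s
  calc ∫⁻ x in Ω, h (Φ x) = ∫⁻ x, Ω.indicator h (Φ.toMeasurableEquiv x) := by
        rw [← lintegral_indicator hΩm]
        congr 1 with x
        by_cases hx : x ∈ Ω <;> simp [hx, hΦΩ]
    _ = ∫⁻ y, Ω.indicator h y ∂(volume.map Φ.toMeasurableEquiv) :=
        (lintegral_map_equiv _ _).symm
    _ ≤ ∫⁻ y, Ω.indicator h y ∂((K : ℝ≥0∞) ^ n • (volume : Measure (Rn n))) :=
        lintegral_mono' hle le_rfl
    _ = _ := by rw [lintegral_smul_measure, lintegral_indicator hΩm, smul_eq_mul]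

theorem LipschitzWith.infEDist_image_le {K : ℝ≥0} {f : Rn n → Rn n} (hf : LipschitzWith K f)
    (hK : K ≠ 0) (x : Rn n) : Metric.infEDist (f x) (f '' S) ≤ K * Metric.infEDist x S := by
  have hK0 : (K : ℝ≥0∞) ≠ 0 := by simpa using hK
  conv_rhs => rw [Metric.infEDist]
  simp_rw [ENNReal.mul_iInf_of_ne hK0 ENNReal.coe_ne_top]
  exact le_iInf₂ fun y hy =>
    (Metric.infEDist_le_edist_of_mem (mem_image_of_mem f hy)).trans (hf x y)

/-- Behaviour of the Hardy constant under a bi-Lipschitz homeomorphism preserving the domain. -/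
theorem hardyConstant_image_le {K : ℝ≥0} (hK : K ≠ 0) (Φ : Rn n ≃ₜ Rn n) (hΦ : LipschitzWith K Φ)
    (hΦ' : LipschitzWith K Φ.symm) (hΩ : IsOpen Ω) (hb : Bornology.IsBounded Ω)
    (hΩne : Ω.Nonempty) (hS : S ⊆ frontier Ω) (hSne : S.Nonempty)
    (hΦΩ : ∀ x, Φ x ∈ Ω ↔ x ∈ Ω) :
    hardyConstant Ω (Φ '' S) ≤ (K : ℝ≥0∞) ^ (2 * (n + 2)) * hardyConstant Ω S := by
  have hK0 : (K : ℝ≥0∞) ≠ 0 := by simpa using hK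
  have hKm0 : (K : ℝ≥0∞) ^ (2 * (n + 2)) ≠ 0 := pow_ne_zero _ hK0
  have hKmt : (K : ℝ≥0∞) ^ (2 * (n + 2)) ≠ ⊤ := ENNReal.pow_ne_top ENNReal.coe_ne_top
  have hΦΩ' : ∀ x, Φ.symm x ∈ Ω ↔ x ∈ Ω := fun x => by rw [← hΦΩ, Φ.apply_symm_apply]
  have hfin := hardyConstant_ne_top hΩ hb hΩne (hSne.image Φ)
  -- As a lower bound for `H(Ω, S)`, the claim needs checking on smooth `ψ` only, where the chain
  -- rule for `ψ ∘ Φ.symm` holds almost everywhere. Numerator and denominator each cost `K ^ (n +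
  -- 2)`: `n` from volume, `2` from the gradient or the distance.
  rw [mul_comm, ← ENNReal.div_le_iff hKm0 hKmt]
  refine le_hardyConstant_of_testFunction hΩ hS hSne (ENNReal.div_ne_top hfin hKm0)
    fun ψ hψ => ?_
  obtain ⟨D, hD⟩ := hψ.exists_lipschitzWith
  have hvL : LipschitzWith (D * K) (ψ ∘ Φ.symm) := hD.comp hΦ'
  have hvs : tsupport (ψ ∘ Φ.symm) ⊆ Ω := by
    rw [tsupport_comp_eq_preimage]
    exact fun x hx => (hΦΩ' x).1 (hψ.tsupport_subset hx)
  have hmem := hvL.memH10 hΩ hb (hψ.hasCompactSupport.comp_homeomorph Φ.symm) hvs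
  have hle := hardyConstant_mul_le (S := Φ '' S) hmem
  have hnum : ∫⁻ x in Ω, ‖gradient (ψ ∘ Φ.symm) x‖ₑ ^ 2 ≤
      (K : ℝ≥0∞) ^ (n + 2) * ∫⁻ x in Ω, ‖gradient ψ x‖ₑ ^ 2 := by
    calc _ ≤ ∫⁻ x in Ω, (K : ℝ≥0∞) ^ 2 * ‖gradient ψ (Φ.symm x)‖ₑ ^ 2 := by
          refine lintegral_mono_ae (ae_restrict_of_ae ?_)
          filter_upwards [hΦ'.ae_differentiableAt] with x hx
          rw [← mul_pow]
          gcongr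
          have h1 : fderiv ℝ (ψ ∘ Φ.symm) x =
              (fderiv ℝ ψ (Φ.symm x)).comp (fderiv ℝ Φ.symm x) :=
            fderiv_comp x (hψ.smooth.differentiable (by simp) _) hx
          have h2 : ‖gradient (ψ ∘ Φ.symm) x‖ ≤ K * ‖gradient ψ (Φ.symm x)‖ := by
            rw [norm_gradient, norm_gradient, h1, mul_comm]
            refine (ContinuousLinearMap.opNorm_comp_le _ _).trans ?_
            gcongr
            exact norm_fderiv_le_of_lipschitz ℝ hΦ'
          have h3 := ENNReal.ofReal_le_ofReal h2
          rwa [ENNReal.ofReal_mul (by positivity), ofReal_norm, ofReal_norm,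
            ENNReal.ofReal_coe_nnreal] at h3
      _ = (K : ℝ≥0∞) ^ 2 * ∫⁻ x in Ω, ‖gradient ψ (Φ.symm x)‖ₑ ^ 2 :=
          lintegral_const_mul' _ _ (ENNReal.pow_ne_top ENNReal.coe_ne_top)
      _ ≤ (K : ℝ≥0∞) ^ 2 * ((K : ℝ≥0∞) ^ n * ∫⁻ x in Ω, ‖gradient ψ x‖ₑ ^ 2) := by
          gcongr
          exact lintegral_comp_homeomorph_le Φ.symm (by simpa using hΦ) hΩ.measurableSet hΦΩ'
            fun x => ‖gradient ψ x‖ₑ ^ 2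
      _ = _ := by ring
  have hden : ∫⁻ x in Ω, ‖ψ x‖ₑ ^ 2 / Metric.infEDist x S ^ 2 ≤ (K : ℝ≥0∞) ^ (n + 2) *
      ∫⁻ x in Ω, ‖(ψ ∘ Φ.symm) x‖ₑ ^ 2 / Metric.infEDist x (Φ '' S) ^ 2 := by
    calc _ ≤ ∫⁻ x in Ω, (K : ℝ≥0∞) ^ 2 *
          (‖(ψ ∘ Φ.symm) (Φ x)‖ₑ ^ 2 / Metric.infEDist (Φ x) (Φ '' S) ^ 2) := by
          refine lintegral_mono fun x => ?_
          simp only [Function.comp_apply, Φ.symm_apply_apply]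
          have h1 := hΦ.infEDist_image_le (S := S) hK x
          rw [← mul_div_assoc, ← ENNReal.mul_div_mul_left (c := (K : ℝ≥0∞) ^ 2) _ _
            (pow_ne_zero 2 hK0) (ENNReal.pow_ne_top ENNReal.coe_ne_top), ← mul_pow _ (Metric.infEDist x S)]
          gcongr
      _ = (K : ℝ≥0∞) ^ 2 * ∫⁻ x in Ω,
          ‖(ψ ∘ Φ.symm) (Φ x)‖ₑ ^ 2 / Metric.infEDist (Φ x) (Φ '' S) ^ 2 :=
          lintegral_const_mul' _ _ (ENNReal.pow_ne_top ENNReal.coe_ne_top)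
      _ ≤ (K : ℝ≥0∞) ^ 2 * ((K : ℝ≥0∞) ^ n *
          ∫⁻ x in Ω, ‖(ψ ∘ Φ.symm) x‖ₑ ^ 2 / Metric.infEDist x (Φ '' S) ^ 2) := by
          gcongr
          exact lintegral_comp_homeomorph_le Φ hΦ' hΩ.measurableSet hΦΩ
            fun x => ‖(ψ ∘ Φ.symm) x‖ₑ ^ 2 / Metric.infEDist x (Φ '' S) ^ 2
      _ = _ := by ring
  rw [← ENNReal.mul_div_right_comm]
  refine ENNReal.div_le_of_le_mul' ?_
  calc _ ≤ hardyConstant Ω (Φ '' S) * ((K : ℝ≥0∞) ^ (n + 2) *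
        ∫⁻ x in Ω, ‖(ψ ∘ Φ.symm) x‖ₑ ^ 2 / Metric.infEDist x (Φ '' S) ^ 2) := by gcongr
    _ = (K : ℝ≥0∞) ^ (n + 2) * (hardyConstant Ω (Φ '' S) *
        ∫⁻ x in Ω, ‖(ψ ∘ Φ.symm) x‖ₑ ^ 2 / Metric.infEDist x (Φ '' S) ^ 2) := by ring
    _ ≤ (K : ℝ≥0∞) ^ (n + 2) * ((K : ℝ≥0∞) ^ (n + 2) *
        ∫⁻ x in Ω, ‖gradient ψ x‖ₑ ^ 2) := mul_le_mul_right (hle.trans hnum) _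
    _ = _ := by ring

end HardyConstant

/-! ### Extension of boundary diffeomorphisms and the final estimate. -/

section Stability

open Filter Topology
open scoped NNReal

theorem one_add_pow_le {x : ℝ} (h0 : 0 ≤ x) (h1 : x ≤ 1) (m : ℕ) :
    (1 + x) ^ m ≤ 1 + 3 ^ m * x := by
  induction m with
  | zero => simp [h0]
  | succ m ih =>
    have h3 : (1 : ℝ) ≤ 3 ^ m := one_le_pow₀ (by norm_num)
    calc (1 + x) ^ (m + 1) ≤ (1 + 3 ^ m * x) * (1 + x) := by
          rw [pow_succ]; gcongr
      _ = 1 + x * (1 + 3 ^ m + 3 ^ m * x) := by ring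
      _ ≤ 1 + x * (3 ^ m + 3 ^ m + 3 ^ m * 1) := by gcongr
      _ = _ := by ring

/-- A perturbation of the identity with Lipschitz constant `κ ≤ 1/2` is a homeomorphism that is
bi-Lipschitz with constant `1 + 2κ`. -/
theorem exists_homeomorph_id_add {E : Type*} [NormedAddCommGroup E] [NormedSpace ℝ E]
    [CompleteSpace E] {e : E → E} {κ : ℝ≥0} (he : LipschitzWith κ e) (hκ : κ ≤ 1 / 2) :
    ∃ Φ : E ≃ₜ E, (∀ x, Φ x = x + e x) ∧ LipschitzWith (1 + 2 * κ) Φ ∧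
      LipschitzWith (1 + 2 * κ) Φ.symm := by
  have hκ' : (κ : ℝ) ≤ 1 / 2 := by exact_mod_cast hκ
  have hκ0 : (0 : ℝ) ≤ κ := κ.2
  have hl : ApproximatesLinearOn (fun x => x + e x)
      ((ContinuousLinearEquiv.refl ℝ E : E ≃L[ℝ] E) : E →L[ℝ] E) univ κ := by
    intro x _ y _
    have h1 : x + e x - (y + e y) - (x - y) = e x - e y := by abel
    simpa [h1] using he.norm_sub_le x y
  have hc : Subsingleton E ∨
      κ < ‖((ContinuousLinearEquiv.refl ℝ E).symm : E →L[ℝ] E)‖₊⁻¹ := by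
    rcases subsingleton_or_nontrivial E with h | h
    · exact Or.inl h
    · right
      have : ‖((ContinuousLinearEquiv.refl ℝ E).symm : E →L[ℝ] E)‖₊ = 1 :=
        ContinuousLinearMap.nnnorm_id
      rw [this, inv_one]
      exact hκ.trans_lt (by norm_num [← NNReal.coe_lt_coe])
  let Φ : E ≃ₜ E := hl.toHomeomorph _ hc
  have hΦ : ∀ x, Φ x = x + e x := fun x => rfl
  refine ⟨Φ, hΦ, LipschitzWith.of_dist_le_mul fun x y => ?_,
    LipschitzWith.of_dist_le_mul fun x y => ?_⟩
  · rw [hΦ, hΦ, dist_eq_norm, dist_eq_norm]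
    have h1 : x + e x - (y + e y) = (x - y) + (e x - e y) := by abel
    have h2 := norm_add_le (x - y) (e x - e y)
    have h3 := he.norm_sub_le x y
    have h4 : 0 ≤ κ * ‖x - y‖ := by positivity
    rw [h1]
    push_cast
    linarith
  · obtain ⟨a, rfl⟩ := Φ.surjective x
    obtain ⟨b, rfl⟩ := Φ.surjective y
    rw [Φ.symm_apply_apply, Φ.symm_apply_apply, hΦ, hΦ, dist_eq_norm, dist_eq_norm]
    have h1 : a - b = (a + e a - (b + e b)) - (e a - e b) := by abel
    have h2 := norm_sub_le (a + e a - (b + e b)) (e a - e b)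
    rw [← h1] at h2
    have h3 := he.norm_sub_le a b
    push_cast
    set X := ‖a - b‖
    set Y := ‖a + e a - (b + e b)‖
    have hX : 0 ≤ X := norm_nonneg _
    have h5 : (1 - κ) * X ≤ Y := by linarith
    have h6 : X ≤ (1 + 2 * κ) * ((1 - κ) * X) := by
      have : 0 ≤ κ * (1 - 2 * κ) * X := by
        apply mul_nonneg (mul_nonneg hκ0 (by linarith)) hX
      linarith
    exact h6.trans (by gcongr)

variable {n : ℕ} {Ω : Set (Rn n)}

theorem norm_le_of_c1Norm {M : Set (Rn n)} {f : Rn n → Rn n} (hf : c1Norm M f ≠ ⊤) :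
    (∀ x ∈ M, ‖f x‖ ≤ (c1Norm M f).toReal) ∧
      ∀ x ∈ M, ‖(fderivWithin ℝ f M x).comp (tangentSubspace M x).subtypeL‖ ≤
        (c1Norm M f).toReal := by
  refine ⟨fun x hx => ?_, fun x hx => ?_⟩
  · rw [← toReal_enorm]
    refine ENNReal.toReal_mono hf (le_trans ?_ le_self_add)
    exact le_iSup₂ (f := fun x (_ : x ∈ M) => ‖f x‖ₑ) x hx
  · refine (toReal_enorm ((fderivWithin ℝ f M x).comp
      (tangentSubspace M x).subtypeL)).symm.trans_le ?_
    refine ENNReal.toReal_mono hf (le_trans ?_ le_add_self)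
    exact le_iSup₂ (f := fun x (_ : x ∈ M) =>
      ‖(fderivWithin ℝ f M x).comp (tangentSubspace M x).subtypeL‖ₑ) x hx

/-- A `C¹` diffeomorphism of a compact smooth boundary that is `C¹` close to the identity extends
to a bi-Lipschitz homeomorphism of the space preserving the domain. -/
theorem exists_homeomorph_extension (hΩ : IsOpen Ω) (hb : Bornology.IsBounded Ω)
    (hs : HasSmoothBoundary Ω) (hne : (frontier Ω).Nonempty) :
    ∃ ε : ℝ, 0 < ε ∧ ∃ A : ℝ≥0, 0 < A ∧ ∀ φ : Rn n → Rn n, IsC1Diffeo (frontier Ω) φ →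
      ∀ δ : ℝ≥0, (δ : ℝ≥0∞) = c1Norm (frontier Ω) (fun x => φ x - x) → (δ : ℝ) < ε →
      A * δ ≤ 1 ∧ ∃ Φ : Rn n ≃ₜ Rn n, EqOn Φ φ (frontier Ω) ∧ LipschitzWith (1 + A * δ) Φ ∧
        LipschitzWith (1 + A * δ) Φ.symm ∧ ∀ x, Φ x ∈ Ω ↔ x ∈ Ω := by
  obtain ⟨C, hC, hlip⟩ := exists_lipschitz_bound_of_smoothBoundary hΩ hb hs
  obtain ⟨ρ, hρ, hρΩ⟩ := exists_uniform_connected_to_ball hΩ hb hs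
  obtain ⟨y, hy⟩ := hne
  obtain ⟨D, hD, hΩD⟩ := hb.subset_ball_lt 0 y
  lift C to ℝ≥0 using hC.le
  set L := lipschitzExtensionConstant (Rn n) with hL
  have hL0 : 0 < L := lipschitzExtensionConstant_pos _
  have hC0 : 0 < C := by exact_mod_cast hC
  set B : ℝ≥0 := L * C with hB
  have hB0 : 0 < B := mul_pos hL0 hC0
  have hBr : (0 : ℝ) < B := by exact_mod_cast hB0
  -- The extension `e` has Lipschitz constant `B * δ`. The first bound makes it at most `1/2`; the
  -- second gives `‖e‖ ≤ δ * (1 + B * D) < ρ / 2` on `Ω`. The constant `2 * B` is the `2κ` of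
  -- `exists_homeomorph_id_add`.
  refine ⟨min (1 / (2 * B)) (ρ / (2 * (1 + B * D))), by positivity, 2 * B, by positivity,
    fun φ hφ δ hδ hδε => ?_⟩
  rw [lt_min_iff, lt_div_iff₀ (by positivity), lt_div_iff₀ (by positivity)] at hδε
  set f : Rn n → Rn n := fun x => φ x - x with hf
  have hfd : DifferentiableOn ℝ f (frontier Ω) :=
    (hφ.contDiffOn.differentiableOn one_ne_zero).sub differentiableOn_id
  have hδr : (c1Norm (frontier Ω) f).toReal = δ := by rw [← hδ]; rfl
  obtain ⟨hf0, hf1⟩ := norm_le_of_c1Norm (M := frontier Ω) (f := f) (by rw [← hδ]; simp)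
  rw [hδr] at hf0 hf1
  have hfl : LipschitzOnWith (C * δ) f (frontier Ω) :=
    LipschitzOnWith.of_dist_le_mul fun a ha b hb => by
      rw [dist_eq_norm, dist_eq_norm]
      simpa using hlip f δ hfd hf0 hf1 b hb a ha
  obtain ⟨e, he, hef⟩ := hfl.extend_finite_dimension
  rw [← hL, ← mul_assoc, ← hB] at he
  have hκ : B * δ ≤ 1 / 2 := by
    rw [← NNReal.coe_le_coe]; push_cast; linarith [hδε.1]
  have hκr : (B * δ : ℝ) ≤ 1 / 2 := by linarith [hδε.1]
  obtain ⟨Φ, hΦ, hΦ1, hΦ2⟩ := exists_homeomorph_id_add he hκ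
  rw [← mul_assoc] at hΦ1 hΦ2
  have hΦφ : EqOn Φ φ (frontier Ω) := fun x hx => by
    rw [hΦ, ← hef hx]; simp [hf]
  have he0 : ∀ x ∈ Ω, 2 * ‖e x‖ < ρ := by
    intro x hx
    have h1 : ‖e y‖ ≤ δ := by rw [← hef hy]; exact hf0 y hy
    have h2 := he.norm_sub_le x y
    have h3 : ‖x - y‖ ≤ D := (mem_ball_iff_norm.1 (hΩD hx)).le
    have h4 : ‖e x‖ ≤ ‖e y‖ + ‖e x - e y‖ := by
      simpa using norm_add_le (e y) (e x - e y)
    have h5 : (B * δ : ℝ) * ‖x - y‖ ≤ B * δ * D := by gcongr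
    push_cast at h2
    linarith [hδε.2]
  obtain ⟨χ, hχ, -, hχφ⟩ := hφ.exists_inverse
  have hdisj : ∀ x ∈ Ω, x ∉ frontier Ω := fun x hx h => by
    rw [hΩ.frontier_eq] at h
    exact h.2 hx
  have hmaps : MapsTo Φ Ω Ω := by
    refine mapsTo_of_dist_lt hΩ hρΩ Φ.continuous (fun x hx => ?_) fun x hx hfr => ?_
    · rw [hΦ, dist_self_add_left]
      linarith [he0 x hx, norm_nonneg (e x)]
    -- Since `φ` is onto `∂Ω`, a boundary value of `Φ` is already attained on `∂Ω`; injectivity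
    -- excludes a preimage in `Ω`.
    · have h1 : Φ (χ (Φ x)) = Φ x := by
        rw [hΦφ (hχ hfr)]; exact hχφ.2 hfr
      exact hdisj x hx (Φ.injective h1 ▸ hχ hfr)
  have hmaps' : MapsTo Φ.symm Ω Ω := by
    refine mapsTo_of_dist_lt hΩ hρΩ Φ.symm.continuous (fun x hx => ?_) fun x hx hfr => ?_
    · set z := Φ.symm x with hz
      have hxz : x = z + e z := by rw [← hΦ, hz, Φ.apply_symm_apply]
      have h1 : dist z x = ‖e z‖ := by rw [hxz]; simp
      have h2 := he.norm_sub_le z x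
      have h3 : ‖z - x‖ = ‖e z‖ := by rw [← dist_eq_norm, h1]
      -- The point `z` is not yet known to lie in `Ω`. The Lipschitz constant `1/2` gives `‖e z‖ ≤ 2
      -- * ‖e x‖ < ρ`, hence the factor `2` in `he0`.
      have h4 : ‖e z‖ ≤ ‖e x‖ + ‖e z - e x‖ := by
        simpa using norm_add_le (e x) (e z - e x)
      rw [h3] at h2
      push_cast at h2
      have h5 : (B * δ : ℝ) * ‖e z‖ ≤ 1 / 2 * ‖e z‖ := by gcongr
      rw [h1]
      linarith [he0 x hx]
    · refine hdisj x hx ?_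
      have := hφ.mapsTo hfr
      rwa [← hΦφ hfr, Φ.apply_symm_apply] at this
  refine ⟨?_, Φ, hΦφ, hΦ1, hΦ2, fun x => ⟨fun h => ?_, fun h => hmaps h⟩⟩
  · rw [← NNReal.coe_le_coe]; push_cast; linarith
  · simpa using hmaps' h

end Stability

theorem theorem5p1 (n : ℕ) (Ω S : Set (Rn n))
    (hΩ_open : IsOpen Ω) (hΩ_bdd : Bornology.IsBounded Ω)
    (hΩ_smooth : HasSmoothBoundary Ω) (hΩ_bdry : (frontier Ω).Nonempty)
    (hS : S ⊆ frontier Ω) :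
    (S.Nonempty → hardyConstant Ω S ≠ ⊤) ∧
    ∃ ε : ℝ, 0 < ε ∧ ∃ c : ℝ, 0 < c ∧
      ∀ φ : Rn n → Rn n, IsC1Diffeo (frontier Ω) φ →
        c1Norm (frontier Ω) (fun x => φ x - x) < ENNReal.ofReal ε →
        |(hardyConstant Ω (φ '' S)).toReal - (hardyConstant Ω S).toReal| ≤
          c * (hardyConstant Ω S).toReal *
            (c1Norm (frontier Ω) (fun x => φ x - x)).toReal := by
  have hΩne : Ω.Nonempty := by
    rw [nonempty_iff_ne_empty]
    rintro rfl
    simp at hΩ_bdry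
  refine ⟨fun h => hardyConstant_ne_top hΩ_open hΩ_bdd hΩne h, ?_⟩
  obtain ⟨ε, hε, A, hA, hext⟩ := exists_homeomorph_extension hΩ_open hΩ_bdd hΩ_smooth hΩ_bdry
  refine ⟨ε, hε, 3 ^ (2 * (n + 2)) * A, by positivity, fun φ hφ hlt => ?_⟩
  rcases S.eq_empty_or_nonempty with rfl | hSne
  · rw [image_empty, sub_self, abs_zero]
    positivity
  obtain ⟨δ, hδ⟩ := WithTop.ne_top_iff_exists.1 hlt.ne_top
  change (δ : ℝ≥0∞) = _ at hδ
  have hδε : (δ : ℝ) < ε := by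
    rw [← hδ, ENNReal.lt_ofReal_iff_toReal_lt ENNReal.coe_ne_top] at hlt
    exact hlt
  obtain ⟨hA1, Φ, hΦφ, hΦ1, hΦ2, hΦΩ⟩ := hext φ hφ δ hδ hδε
  have himg : Φ '' S = φ '' S := (hΦφ.mono hS).image_eq
  have hφS : Φ '' S ⊆ frontier Ω := by
    rw [himg]; exact (hφ.mapsTo.mono_left hS).image_subset
  have hK : 1 + A * δ ≠ 0 := by positivity
  have h1 := hardyConstant_image_le hK Φ hΦ1 hΦ2 hΩ_open hΩ_bdd hΩne hS hSne hΦΩ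
  have h2 := hardyConstant_image_le hK Φ.symm hΦ2 (by simpa using hΦ1) hΩ_open hΩ_bdd hΩne hφS
    (hSne.image Φ) fun x => by rw [← hΦΩ, Φ.apply_symm_apply]
  rw [← image_comp, Φ.symm_comp_self, image_id] at h2
  rw [himg] at h1 h2
  have hH := hardyConstant_ne_top hΩ_open hΩ_bdd hΩne hSne
  have hH' := hardyConstant_ne_top hΩ_open hΩ_bdd hΩne (hSne.image φ)
  have hKt : ((1 + A * δ : NNReal) : ℝ≥0∞) ^ (2 * (n + 2)) ≠ ⊤ :=
    ENNReal.pow_ne_top ENNReal.coe_ne_top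
  have h1r := ENNReal.toReal_mono (ENNReal.mul_ne_top hKt hH) h1
  have h2r := ENNReal.toReal_mono (ENNReal.mul_ne_top hKt hH') h2
  rw [ENNReal.toReal_mul, ENNReal.toReal_pow, ENNReal.coe_toReal] at h1r h2r
  have hδr : (c1Norm (frontier Ω) (fun x => φ x - x)).toReal = δ := by rw [← hδ]; rfl
  rw [hδr]
  set H := (hardyConstant Ω S).toReal
  set H' := (hardyConstant Ω (φ '' S)).toReal
  have hH0 : 0 ≤ H := ENNReal.toReal_nonneg
  have hH0' : 0 ≤ H' := ENNReal.toReal_nonneg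
  have hpow := one_add_pow_le (x := A * δ) (by positivity) (by exact_mod_cast hA1) (2 * (n + 2))
  push_cast at h1r h2r
  set P := (1 + (A : ℝ) * δ) ^ (2 * (n + 2))
  set t : ℝ := 3 ^ (2 * (n + 2)) * (A * δ) with ht
  have ht0 : 0 ≤ t := by positivity
  have h3 : H' ≤ H + t * H := by
    have : P * H ≤ (1 + t) * H := by gcongr
    linarith
  -- The comparison by `Φ.symm` gives `t * H'`; it is replaced by `t * H` when `H' ≤ H`, and
  -- otherwise the left side is nonpositive.
  have h4 : H - H' ≤ t * H := by
    rcases le_total H H' with h | h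
    · have : 0 ≤ t * H := by positivity
      linarith
    · have h5 : P * H' ≤ (1 + t) * H' := by gcongr
      have h6 : t * H' ≤ t * H := by gcongr
      linarith
  have h7 : 3 ^ (2 * (n + 2)) * A * H * δ = t * H := by rw [ht]; ring
  rw [h7, abs_le]
  exact ⟨by linarith, by linarith⟩
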